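/- All algebras are over $\mathbb{C}$. For a Banach algebra $A$, an element $a\in A$ is \emph{compact} if the operator $x\mapsto axa$ on $A$ is compact, and $K(A)$ denotes the set of compact elements of $A$. A \emph{uniform algebra} is a commutative Banach algebra $A$ (not necessarily unital) with $\|a^2\|=\|a\|^2$ for all $a\in A$. For a commutative Banach algebra $A$, the \emph{multiplier algebra} $M(A)$ is the algebra of all bounded linear operators $T:A\to A$ with $T(ab)=aT(b)$ for all $a,b\in A$, with composition as product and the operator norm; if $A$ is an abelian C$^*$-algebra, $M(A)$ carries the involution $T^*(a)=(T(a^*))^*$. \textbf{Theorem.} (i) Let $A$ be a separable non-unital uniform algebra with $K(A)=\{0\}$. Then there exist a subalgebra $D\subseteq\ell_\infty$ and an isometric algebra isomorphism of $M(A)$ onto $D$ such that $D\cap c_0=\{0\}$. (ii) Let $A$ be a separable abelian C$^*$-algebra (unital or not) with $K(A)=\{0\}$. Then there exist a $^*$-subalgebra $D\subseteq\ell_\infty$ and an isometric $^*$-isomorphism of $M(A)$ onto $D$ such that $D\cap c_0=\{0\}$. Here $\ell_\infty$ is the C$^*$-algebra of bounded complex sequences indexed by $\mathbb{N}$ with pointwise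 operations and the supremum norm, $c_0\subseteq\ell_\infty$ is the ideal of sequences converging to $0$, and in neither part is $D$ required to contain the unit of $\ell_\infty$. -/

import Mathlib

open Filter Topology
open scoped ENNReal

/-- The complex Banach algebra `ℓ∞` of bounded complex sequences: pointwise operations,
supremum norm, pointwise conjugation as involution. -/
abbrev EllInfty : Type := lp (fun _ : ℕ => ℂ) ∞

/-- `c₀`, the subspace of `ℓ∞` of sequences that converge to `0`. -/
def cZero : Submodule ℂ EllInfty where
  carrier := {x | Tendsto (fun n => x n) atTop (𝓝 0)}
  zero_mem' := by simp
  add_mem' := by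
    intro x y hx hy
    simpa using Tendsto.add hx hy
  smul_mem' := by
    intro c x hx
    simpa using Tendsto.const_smul hx c

/-- `K(A)`: the set of compact elements of `A`, those `a` for which the operator
`x ↦ a * x * a` on `A` is compact. -/
def compactElements (A : Type*) [NonUnitalNormedRing A] : Set A :=
  {a | IsCompactOperator (fun x : A => a * x * a)}

/-- A (not necessarily unital) complex Banach algebra is a uniform algebra if it is commutative and
`‖a²‖ = ‖a‖²` for all `a`; commutativity, completeness and the complex structure are carried by the
instances. -/
def IsUniformAlgebra (A : Type*) [NonUnitalNormedCommRing A] [NormedSpace ℂ A]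
    [SMulCommClass ℂ A A] [IsScalarTower ℂ A A] [CompleteSpace A] : Prop :=
  ∀ a : A, ‖a * a‖ = ‖a‖ ^ 2

/-- `A` has a unit element. -/
def HasUnit (A : Type*) [NonUnitalNormedCommRing A] : Prop :=
  ∃ e : A, ∀ a : A, e * a = a

/-- The multiplier algebra `M(A)` of a commutative complex Banach algebra: the bounded operators `T`
on `A` with `T (a * b) = a * T b`, with composition as product and with the operator norm. -/
def multiplierAlgebra (A : Type*) [NonUnitalNormedCommRing A] [NormedSpace ℂ A]
    [SMulCommClass ℂ A A] : Subalgebra ℂ (A →L[ℂ] A) where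
  carrier := {T | ∀ a b : A, T (a * b) = a * T b}
  mul_mem' := by
    intro S T hS hT a b
    change ∀ a b : A, _ at hS hT
    simp [hS, hT]
  add_mem' := by
    intro S T hS hT a b
    change ∀ a b : A, _ at hS hT
    simp [hS, hT, mul_add]
  algebraMap_mem' := by
    intro c a b
    simp [Algebra.algebraMap_eq_smul_one, mul_smul_comm]

namespace multiplierAlgebra

variable {A : Type*} [NonUnitalCommCStarAlgebra A]

/-- The involution of `M(A)` for an abelian C⋆-algebra `A`: `T⋆ a = (T a⋆)⋆`. It extends the
involution of `A`, since `z⋆ * a = (z * a⋆)⋆`. -/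
noncomputable instance instStar : Star (multiplierAlgebra A) where
  star T :=
    ⟨(((starₗᵢ ℂ : A ≃ₗᵢ⋆[ℂ] A) : A →L⋆[ℂ] A).comp (T : A →L[ℂ] A)).comp
      ((starₗᵢ ℂ : A ≃ₗᵢ⋆[ℂ] A) : A →L⋆[ℂ] A), by
      intro a b
      have h := T.2 (star a) (star b)
      change star ((T : A →L[ℂ] A) (star (a * b))) = a * star ((T : A →L[ℂ] A) (star b))
      rw [star_mul, mul_comm (star b), h, star_mul, star_star, mul_comm]⟩

theorem star_apply (T : multiplierAlgebra A) (a : A) :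
    (star T : multiplierAlgebra A).1 a = star (T.1 (star a)) := rfl

end multiplierAlgebra

/-!
A character `φ` of `A` extends to a character `χ` of `M(A)` with `φ (T b) = χ T * φ b`, and if a
family of characters computes the norm of `A`, then the extended family computes the norm of
`M(A)`. By Gelfand theory, a separable uniform algebra has such a sequence: at each point of a dense
sequence, choose a character at which the norm is attained. Evaluation at the extended characters
embeds `M(A)` isometrically into `ℓ∞`, and once every character is repeated infinitely often, a
sequence in the range can converge to `0` only if it vanishes.
-/

theorem character_apply_invFun_one {A : Type*} [NonUnitalNonAssocSemiring A] [DistribMulAction ℂ A]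
    {φ : A →ₙₐ[ℂ] ℂ} (hφ : φ ≠ 0) : φ (Function.invFun φ 1) = 1 := by
  obtain ⟨a, ha⟩ := DFunLike.ne_iff.mp hφ
  exact Function.invFun_eq ⟨(φ a)⁻¹ • a, by rw [map_smul, smul_eq_mul, inv_mul_cancel₀ ha]⟩

section Characters

variable {A : Type*} [NonUnitalNormedRing A] [NormedSpace ℂ A] [SMulCommClass ℂ A A]
  [IsScalarTower ℂ A A]

theorem quasispectrum_eq_spectrum_toLp_inr (a : A) :
    quasispectrum ℂ a = spectrum ℂ (WithLp.toLp 1 (a : Unitization ℂ A)) := by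
  rw [Unitization.quasispectrum_eq_spectrum_inr' ℂ ℂ,
    ← AlgEquiv.spectrum_eq (WithLp.unitizationAlgEquiv ℂ (𝕜 := ℂ) (A := A))]
  rfl

theorem norm_character_apply_le [CompleteSpace A] (φ : A →ₙₐ[ℂ] ℂ) (a : A) : ‖φ a‖ ≤ ‖a‖ := by
  have : NormOneClass (WithLp 1 (Unitization ℂ A)) := ⟨by
    rw [WithLp.unitization_norm_def]
    change ‖(1 : Unitization ℂ A).fst‖ + ‖(1 : Unitization ℂ A).snd‖ = 1
    simp⟩
  let ψ : WithLp 1 (Unitization ℂ A) →ₐ[ℂ] ℂ :=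
    (Unitization.lift φ).comp (WithLp.unitizationAlgEquiv ℂ).toAlgHom
  calc ‖φ a‖ = ‖ψ (WithLp.toLp 1 (a : Unitization ℂ A))‖ := by simp [ψ]
    _ ≤ ‖WithLp.toLp 1 (a : Unitization ℂ A)‖ := AlgHom.norm_apply_le_self ψ _
    _ = ‖a‖ := WithLp.unitization_norm_inr a

end Characters

theorem exists_character_apply_eq_of_mem_quasispectrum {A : Type*} [NonUnitalNormedCommRing A]
    [NormedSpace ℂ A] [SMulCommClass ℂ A A] [IsScalarTower ℂ A A] [CompleteSpace A] {a : A} {z : ℂ}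
    (hz : z ∈ quasispectrum ℂ a) : ∃ φ : A →ₙₐ[ℂ] ℂ, φ a = z := by
  let _ : NormedCommRing (WithLp 1 (Unitization ℂ A)) :=
    { WithLp.instUnitizationNormedRing with
      mul_comm x y := WithLp.ofLp_injective 1 (mul_comm x.ofLp y.ofLp) }
  rw [quasispectrum_eq_spectrum_toLp_inr] at hz
  obtain ⟨f, rfl⟩ := WeakDual.CharacterSpace.mem_spectrum_iff_exists.mp hz
  exact ⟨Unitization.lift.symm <| (WeakDual.CharacterSpace.toAlgHom f).comp
    (WithLp.unitizationAlgEquiv ℂ).symm.toAlgHom, rfl⟩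

theorem character_map_star {A : Type*} [NonUnitalCStarAlgebra A] (φ : A →ₙₐ[ℂ] ℂ) (a : A) :
    φ (star a) = star (φ a) := by
  have := AlgHomClass.instStarHomClass (F := Unitization ℂ A →ₐ[ℂ] ℂ)
  simpa using map_star (Unitization.lift φ) (a : Unitization ℂ A)

/-- A family of characters is norming if `‖a‖ = sup_i |φ_i a|` for all `a`. The supremum is stated
as a least upper bound, so that boundedness and `ι ≠ ∅` are part of the notion. -/
def IsNorming {ι A : Type*} [NonUnitalNormedRing A] [NormedSpace ℂ A] (φ : ι → A →ₙₐ[ℂ] ℂ) : Prop :=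
  ∀ a, IsLUB (Set.range fun i => ‖φ i a‖) ‖a‖

namespace IsNorming

variable {ι A : Type*} [NonUnitalNormedRing A] [NormedSpace ℂ A] {φ : ι → A →ₙₐ[ℂ] ℂ}

theorem norm_apply_le (hφ : IsNorming φ) (i : ι) (a : A) : ‖φ i a‖ ≤ ‖a‖ :=
  (hφ a).1 (Set.mem_range_self i)

theorem nonempty (hφ : IsNorming φ) : Nonempty ι :=
  Set.range_nonempty_iff_nonempty.mp (hφ 0).nonempty

theorem comp_surjective {κ : Type*} (hφ : IsNorming φ) {e : κ → ι} (he : e.Surjective) :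
    IsNorming (φ ∘ e) := fun a => by
  simpa only [← he.range_comp] using! hφ a

/-- The embedding `a ↦ (φ_i a)_i` into bounded families given by a norming family `φ`. -/
noncomputable def toLpInfty (hφ : IsNorming φ) : A →ₙₐ[ℂ] lp (fun _ : ι => ℂ) ∞ where
  toFun a := ⟨fun i => φ i a, memℓp_infty (hφ a).bddAbove⟩
  map_smul' c a := by ext i; exact map_smul (φ i) c a
  map_zero' := by ext i; exact map_zero (φ i)
  map_add' a b := by ext i; exact map_add (φ i) a b
  map_mul' a b := by ext i; exact map_mul (φ i) a b

theorem toLpInfty_apply (hφ : IsNorming φ) (a : A) (i : ι) : hφ.toLpInfty a i = φ i a := rfl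

theorem isometry_toLpInfty (hφ : IsNorming φ) : Isometry hφ.toLpInfty :=
  have := hφ.nonempty
  AddMonoidHomClass.isometry_of_norm _ fun a => (lp.isLUB_norm _).unique (hφ a)

end IsNorming

theorem exists_seq_isNorming {A : Type*} [NonUnitalNormedRing A] [NormedSpace ℂ A]
    [SMulCommClass ℂ A A] [IsScalarTower ℂ A A] [CompleteSpace A]
    [TopologicalSpace.SeparableSpace A] (hA : ∀ a : A, ∃ φ : A →ₙₐ[ℂ] ℂ, ‖φ a‖ = ‖a‖) :
    ∃ φ : ℕ → A →ₙₐ[ℂ] ℂ, IsNorming φ := by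
  choose φ hφ using hA
  let d := TopologicalSpace.denseSeq A
  refine ⟨fun n => φ (d n), fun a => ⟨?_, fun C hC => ?_⟩⟩
  · rintro _ ⟨n, rfl⟩
    exact norm_character_apply_le _ a
  · refine le_of_forall_pos_le_add fun ε hε => ?_
    obtain ⟨n, hn⟩ := (TopologicalSpace.denseRange_denseSeq A).exists_dist_lt a (half_pos hε)
    have hφa : ‖φ (d n) a‖ ≤ C := hC (Set.mem_range_self n)
    have hφd : ‖φ (d n) (d n - a)‖ ≤ ‖d n - a‖ := norm_character_apply_le _ _
    have hnd : ‖d n - a‖ < ε / 2 := by rwa [← dist_eq_norm, dist_comm]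
    calc ‖a‖ ≤ ‖d n‖ + ‖d n - a‖ := norm_le_norm_add_norm_sub _ _
      _ = ‖φ (d n) a + φ (d n) (d n - a)‖ + ‖d n - a‖ := by
        rw [← map_add, add_sub_cancel, hφ]
      _ ≤ ‖φ (d n) a‖ + ‖φ (d n) (d n - a)‖ + ‖d n - a‖ := by gcongr; exact norm_add_le _ _
      _ ≤ C + ε := by linarith

namespace IsUniformAlgebra

variable {A : Type*} [NonUnitalNormedCommRing A] [NormedSpace ℂ A] [SMulCommClass ℂ A A]
  [IsScalarTower ℂ A A] [CompleteSpace A]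

theorem norm_toLp_inr_pow_two_pow (hA : IsUniformAlgebra A) (a : A) (n : ℕ) :
    ‖WithLp.toLp 1 (a : Unitization ℂ A) ^ 2 ^ n‖ = ‖a‖ ^ 2 ^ n := by
  induction n generalizing a with
  | zero => simp [WithLp.unitization_norm_inr]
  | succ n ih =>
    have hsq : WithLp.toLp 1 (a : Unitization ℂ A) ^ 2 =
        WithLp.toLp 1 ((a * a : A) : Unitization ℂ A) :=
      WithLp.ofLp_injective 1 (by simp [sq])
    rw [pow_succ', pow_mul, hsq, ih, hA, pow_mul]

theorem spectralRadius_toLp_inr (hA : IsUniformAlgebra A) (a : A) :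
    spectralRadius ℂ (WithLp.toLp 1 (a : Unitization ℂ A)) = ‖a‖₊ := by
  have hgelfand := (spectrum.pow_nnnorm_pow_one_div_tendsto_nhds_spectralRadius
    (WithLp.toLp 1 (a : Unitization ℂ A))).comp (tendsto_pow_atTop_atTop_of_one_lt one_lt_two)
  refine tendsto_nhds_unique hgelfand (tendsto_const_nhds.congr fun n => ?_)
  have hn : ‖WithLp.toLp 1 (a : Unitization ℂ A) ^ 2 ^ n‖₊ = ‖a‖₊ ^ 2 ^ n :=
    NNReal.eq (by simpa using hA.norm_toLp_inr_pow_two_pow a n)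
  rw [Function.comp_apply, hn, ENNReal.coe_pow, ← ENNReal.rpow_natCast, ← ENNReal.rpow_mul]
  simp

theorem exists_mem_quasispectrum_norm_eq (hA : IsUniformAlgebra A) (a : A) :
    ∃ z ∈ quasispectrum ℂ a, ‖z‖ = ‖a‖ := by
  obtain ⟨z, hz, hza⟩ :=
    spectrum.exists_nnnorm_eq_spectralRadius (WithLp.toLp 1 (a : Unitization ℂ A))
  rw [hA.spectralRadius_toLp_inr, ENNReal.coe_inj] at hza
  exact ⟨z, quasispectrum_eq_spectrum_toLp_inr a ▸ hz, congrArg NNReal.toReal hza⟩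

theorem exists_character_norm_eq (hA : IsUniformAlgebra A) (a : A) :
    ∃ φ : A →ₙₐ[ℂ] ℂ, ‖φ a‖ = ‖a‖ := by
  obtain ⟨z, hz, hza⟩ := hA.exists_mem_quasispectrum_norm_eq a
  obtain ⟨φ, rfl⟩ := exists_character_apply_eq_of_mem_quasispectrum hz
  exact ⟨φ, hza⟩

theorem of_nonUnitalCommCStarAlgebra (A : Type*) [NonUnitalCommCStarAlgebra A] :
    IsUniformAlgebra A := fun a => by
  have hstar : star (a * a) * (a * a) = star (star a * a) * (star a * a) := by
    simp only [star_mul, star_star, mul_mul_mul_comm]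
  have hsq : ‖a * a‖ ^ 2 = (‖a‖ ^ 2) ^ 2 := by
    simp only [sq, ← CStarRing.norm_star_mul_self, hstar]
  exact (pow_left_inj₀ (norm_nonneg _) (by positivity) two_ne_zero).mp hsq

end IsUniformAlgebra

namespace multiplierAlgebra

section

variable {A : Type*} [NonUnitalNormedCommRing A] [NormedSpace ℂ A] [SMulCommClass ℂ A A]

theorem isClosed : IsClosed (multiplierAlgebra A : Set (A →L[ℂ] A)) := by
  change IsClosed {T : A →L[ℂ] A | ∀ a b, T (a * b) = a * T b}
  simp only [Set.ofPred_forall]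
  exact isClosed_iInter fun a => isClosed_iInter fun b => isClosed_eq (by fun_prop) (by fun_prop)

instance [CompleteSpace A] : CompleteSpace (multiplierAlgebra A) :=
  isClosed.completeSpace_coe

theorem character_map_mul_comm (φ : A →ₙₐ[ℂ] ℂ) (T : multiplierAlgebra A) (a b : A) :
    φ (T.1 a) * φ b = φ a * φ (T.1 b) := by
  rw [← map_mul, ← map_mul, mul_comm, ← T.2 b a, ← T.2 a b, mul_comm]

theorem character_map_invFun_one_mul (φ : A →ₙₐ[ℂ] ℂ) (T : multiplierAlgebra A) (b : A) :
    φ (T.1 (Function.invFun φ 1)) * φ b = φ (T.1 b) := by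
  rcases eq_or_ne φ 0 with rfl | hφ
  · simp
  · rw [character_map_mul_comm, character_apply_invFun_one hφ, one_mul]

/-- The extension of a character `φ` of `A` to `M(A)`, namely `T ↦ φ (T e)` for any `e` with
`φ e = 1`. If `φ = 0`, there is no such `e` and the extension is `0`. -/
noncomputable def extendCharacter (φ : A →ₙₐ[ℂ] ℂ) : multiplierAlgebra A →ₙₐ[ℂ] ℂ where
  toFun T := φ (T.1 (Function.invFun φ 1))
  map_smul' c T := map_smul φ c (T.1 _)
  map_zero' := map_zero φ
  map_add' S T := map_add φ (S.1 _) (T.1 _)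
  map_mul' S T := (character_map_invFun_one_mul φ S (T.1 _)).symm

theorem extendCharacter_mul_apply (φ : A →ₙₐ[ℂ] ℂ) (T : multiplierAlgebra A) (b : A) :
    extendCharacter φ T * φ b = φ (T.1 b) :=
  character_map_invFun_one_mul φ T b

end

theorem isNorming_extendCharacter {A ι : Type*} [NonUnitalNormedCommRing A] [NormedSpace ℂ A]
    [SMulCommClass ℂ A A] [CompleteSpace A] {φ : ι → A →ₙₐ[ℂ] ℂ}
    (hφ : IsNorming φ) : IsNorming fun i => extendCharacter (φ i) := by
  refine fun T => ⟨?_, fun C hC => ?_⟩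
  · rintro _ ⟨i, rfl⟩
    exact norm_character_apply_le _ T
  · have hχ : ∀ i, ‖extendCharacter (φ i) T‖ ≤ C := Set.forall_mem_range.mp hC
    have hC₀ : 0 ≤ C := (norm_nonneg _).trans (hχ hφ.nonempty.some)
    refine T.1.opNorm_le_bound hC₀ fun b => (hφ (T.1 b)).2 (Set.forall_mem_range.mpr fun i => ?_)
    calc ‖φ i (T.1 b)‖ = ‖extendCharacter (φ i) T‖ * ‖φ i b‖ := by
          rw [← norm_mul, extendCharacter_mul_apply]
      _ ≤ C * ‖b‖ := mul_le_mul (hχ i) (hφ.norm_apply_le i b) (norm_nonneg _) hC₀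

theorem extendCharacter_star {A : Type*} [NonUnitalCommCStarAlgebra A] (φ : A →ₙₐ[ℂ] ℂ)
    (T : multiplierAlgebra A) : extendCharacter φ (star T) = star (extendCharacter φ T) := by
  rcases eq_or_ne φ 0 with rfl | hφ
  · exact star_zero ℂ |>.symm
  · obtain ⟨b, hb⟩ := DFunLike.ne_iff.mp hφ
    refine mul_right_cancel₀ hb ?_
    rw [extendCharacter_mul_apply, star_apply, character_map_star, ← extendCharacter_mul_apply,
      character_map_star, star_mul', star_star]

end multiplierAlgebra

theorem eq_zero_of_mem_cZero_of_frequently_eq {x : EllInfty} (hx : x ∈ cZero)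
    (hrep : ∀ k, ∃ᶠ n in atTop, x n = x k) : x = 0 := by
  ext k
  exact (isClosed_singleton.mem_of_frequently_of_tendsto (hrep k) hx).symm

theorem frequently_unpair_snd_eq (m : ℕ) : ∃ᶠ n in atTop, (Nat.unpair n).2 = m :=
  frequently_atTop.mpr fun N => ⟨Nat.pair N m, Nat.left_le_pair N m, by rw [Nat.unpair_pair]⟩

namespace IsNorming

variable {A : Type*} [NonUnitalNormedRing A] [NormedSpace ℂ A] {φ : ℕ → A →ₙₐ[ℂ] ℂ}

theorem comp_unpair_snd (hφ : IsNorming φ) : IsNorming fun n => φ (Nat.unpair n).2 :=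
  hφ.comp_surjective fun m => (frequently_unpair_snd_eq m).exists

theorem range_toLpInfty_comp_unpair_snd_inter_cZero (hφ : IsNorming φ) :
    Set.range hφ.comp_unpair_snd.toLpInfty ∩ (cZero : Set EllInfty) = {0} := by
  refine Set.eq_singleton_iff_unique_mem.mpr ⟨⟨⟨0, map_zero _⟩, zero_mem _⟩, ?_⟩
  rintro _ ⟨⟨a, rfl⟩, ha⟩
  refine eq_zero_of_mem_cZero_of_frequently_eq ha fun k => ?_
  refine (frequently_unpair_snd_eq (Nat.unpair k).2).mono fun n hn => ?_
  simp only [toLpInfty_apply, hn]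

end IsNorming

theorem IsUniformAlgebra.exists_seq_isNorming_multiplierAlgebra {A : Type*}
    [NonUnitalNormedCommRing A] [NormedSpace ℂ A] [SMulCommClass ℂ A A] [IsScalarTower ℂ A A]
    [CompleteSpace A] [TopologicalSpace.SeparableSpace A] (hA : IsUniformAlgebra A) :
    ∃ φ : ℕ → A →ₙₐ[ℂ] ℂ, IsNorming fun n => multiplierAlgebra.extendCharacter (φ n) :=
  let ⟨φ, hφ⟩ := exists_seq_isNorming hA.exists_character_norm_eq
  ⟨φ, multiplierAlgebra.isNorming_extendCharacter hφ⟩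

theorem mainTheorem2_general :
    (∀ (A : Type*) [NonUnitalNormedCommRing A] [NormedSpace ℂ A] [SMulCommClass ℂ A A]
        [IsScalarTower ℂ A A] [CompleteSpace A] [TopologicalSpace.SeparableSpace A],
      IsUniformAlgebra A →
        ∃ D : NonUnitalSubalgebra ℂ EllInfty,
          (∃ Φ : multiplierAlgebra A →ₙₐ[ℂ] EllInfty,
            Isometry Φ ∧ NonUnitalAlgHom.range Φ = D) ∧
          (D : Set EllInfty) ∩ (cZero : Set EllInfty) = {0}) ∧
    (∀ (A : Type*) [NonUnitalCommCStarAlgebra A] [TopologicalSpace.SeparableSpace A],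
      ∃ D : NonUnitalStarSubalgebra ℂ EllInfty,
        (∃ Φ : multiplierAlgebra A →⋆ₙₐ[ℂ] EllInfty,
          Isometry Φ ∧ NonUnitalStarAlgHom.range Φ = D) ∧
        (D : Set EllInfty) ∩ (cZero : Set EllInfty) = {0}) := by
  refine ⟨fun A _ _ _ _ _ _ hA => ?_, fun A _ _ => ?_⟩
  · obtain ⟨φ, hφ⟩ := hA.exists_seq_isNorming_multiplierAlgebra
    let Φ : multiplierAlgebra A →ₙₐ[ℂ] EllInfty := hφ.comp_unpair_snd.toLpInfty
    exact ⟨NonUnitalAlgHom.range Φ, ⟨Φ, hφ.comp_unpair_snd.isometry_toLpInfty, rfl⟩,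
      hφ.range_toLpInfty_comp_unpair_snd_inter_cZero⟩
  · obtain ⟨φ, hφ⟩ :=
      (IsUniformAlgebra.of_nonUnitalCommCStarAlgebra A).exists_seq_isNorming_multiplierAlgebra
    let Φ : multiplierAlgebra A →⋆ₙₐ[ℂ] EllInfty :=
      { hφ.comp_unpair_snd.toLpInfty with
        map_star' := fun T => by
          ext n
          exact multiplierAlgebra.extendCharacter_star (φ (Nat.unpair n).2) T }
    exact ⟨NonUnitalStarAlgHom.range Φ, ⟨Φ, hφ.comp_unpair_snd.isometry_toLpInfty, rfl⟩,
      hφ.range_toLpInfty_comp_unpair_snd_inter_cZero⟩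

theorem mainTheorem2 :
    (∀ (A : Type*) [NonUnitalNormedCommRing A] [NormedSpace ℂ A] [SMulCommClass ℂ A A]
        [IsScalarTower ℂ A A] [CompleteSpace A] [TopologicalSpace.SeparableSpace A],
      IsUniformAlgebra A → ¬ HasUnit A → compactElements A = {0} →
        ∃ D : NonUnitalSubalgebra ℂ EllInfty,
          (∃ Φ : multiplierAlgebra A →ₙₐ[ℂ] EllInfty,
            Isometry Φ ∧ NonUnitalAlgHom.range Φ = D) ∧
          (D : Set EllInfty) ∩ (cZero : Set EllInfty) = {0}) ∧
    (∀ (A : Type*) [NonUnitalCommCStarAlgebra A] [TopologicalSpace.SeparableSpace A],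
      compactElements A = {0} →
        ∃ D : NonUnitalStarSubalgebra ℂ EllInfty,
          (∃ Φ : multiplierAlgebra A →⋆ₙₐ[ℂ] EllInfty,
            Isometry Φ ∧ NonUnitalStarAlgHom.range Φ = D) ∧
          (D : Set EllInfty) ∩ (cZero : Set EllInfty) = {0}) :=
  mainTheorem2_general.imp (fun h A _ _ _ _ _ _ hA _ _ => h A hA) fun h A _ _ _ => h A
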